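/- Let $n\ge 2$, $[n]=\{1,\dots,n\}$, and let $\{D_I\}$ be a family of positive real numbers indexed by the $2$-element subsets $I$ of $[n]$. Write $D_{i,j}=D_{\{i,j\}}$ for $i\ne j$ and $D_{i,i}=0$. A caterpillar is a finite tree whose vertices of degree at least $2$ are exactly the vertices of a (possibly empty) path. In a positive-weighted graph $\mathcal G=(G,w)$ (all edge weights $w(e)>0$), the $2$-weight $D_{i,j}(\mathcal G)$ (for distinct vertices $i,j$) is the minimum of the total edge weight $w(H)$ over all connected subgraphs $H$ of $G$ containing $i$ and $j$. The family $\{D_I\}$ is caterpillarlike if there is a positive-weighted caterpillar $\mathcal C$ with vertex set $[n]$ such that $D_{i,j}(\mathcal C)=D_{i,j}$ for all distinct $i,j\in[n]$. For $x\in[n]$ put $$t_x=\tfrac12\min_{y,z\in[n]\setminus\{x\}}\bigl(D_{x,y}+D_{x,z}-D_{y,z}\bigr)$$ (the case $y=z$ is allowed), and let $a\neq b$ in $[n]$ be such that $$D_{a,b}-t_a-t_b=\max_{i,j\in[n],\ i\ne j}\{D_{i,j}-t_i-t_j\}.$$ Then $\{D_I\}$ is caterpillarlike if and only if the following three conditions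 hold: (i) (four-point condition) for all pairwise distinct $i,j,k,h\in[n]$, the maximum of $D_{i,j}+D_{k,h}$, $D_{i,k}+D_{j,h}$, $D_{i,h}+D_{k,j}$ is attained at least twice; (ii) (median condition) for all pairwise distinct $x,y,z\in[n]$ there is a unique $m\in[n]$ such that $D_{i,j}=D_{i,m}+D_{j,m}$ for all distinct $i,j\in\{x,y,z\}$; (iii) $D_{a,b}+D_{i,j}\ge\max\{D_{a,i}+D_{b,j},\,D_{a,j}+D_{b,i}\}$ for all distinct $i,j\in[n]\setminus\{a,b\}$. -/

import Mathlib

/-- A family `{D_I}` of real numbers indexed by the `2`-element subsets `I` of the vertex set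
`[n]`, modelled by `Fin n`. -/
abbrev PairFamily (n : ℕ) : Type := {I : Finset (Fin n) // I.card = 2} → ℝ

namespace PairFamily

variable {n : ℕ} (D : PairFamily n)

/-- `D_{i,j} = D_{{i,j}}` for `i ≠ j`, with the usual convention `D_{i,i} = 0`. -/
def entry (i j : Fin n) : ℝ :=
  if h : i ≠ j then D ⟨{i, j}, Finset.card_pair h⟩ else 0

/-- All members of the family are positive. -/
def IsPositive : Prop := ∀ I, 0 < D I

/-- The maximum of the three numbers is attained at least twice. -/
def _root_.MaxAttainedTwice (x y z : ℝ) : Prop :=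
  (x = y ∧ z ≤ x) ∨ (x = z ∧ y ≤ x) ∨ (y = z ∧ x ≤ y)

/-- The four-point condition, over pairwise distinct `i, j, k, h`. -/
def FourPoint : Prop :=
  ∀ i j k h : Fin n, i ≠ j → i ≠ k → i ≠ h → j ≠ k → j ≠ h → k ≠ h →
    MaxAttainedTwice (D.entry i j + D.entry k h) (D.entry i k + D.entry j h)
      (D.entry i h + D.entry k j)

/-- Median family: any three distinct elements of `[n]` have a unique median in `[n]`. -/
def IsMedian : Prop :=
  ∀ a b c : Fin n, a ≠ b → a ≠ c → b ≠ c →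
    ∃! m : Fin n, ∀ i ∈ ({a, b, c} : Set (Fin n)), ∀ j ∈ ({a, b, c} : Set (Fin n)), i ≠ j →
      D.entry i j = D.entry i m + D.entry j m

/-- `t_x = ½ min {D_{x,y} + D_{x,z} - D_{y,z} : y, z ≠ x}`; `y = z` is allowed. The set is finite,
and nonempty as soon as `n ≥ 2`, so that its infimum is its minimum. -/
noncomputable def t (x : Fin n) : ℝ :=
  (1 / 2) * sInf {r : ℝ | ∃ y z : Fin n, y ≠ x ∧ z ≠ x ∧
    r = D.entry x y + D.entry x z - D.entry y z}

/-- `a, b` are two elements of `[n]` at which `D_{i,j} - t_i - t_j` (with `i ≠ j`) is maximal. -/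
def IsMaxPair (a b : Fin n) : Prop :=
  a ≠ b ∧ ∀ i j : Fin n, i ≠ j →
    D.entry i j - D.t i - D.t j ≤ D.entry a b - D.t a - D.t b

end PairFamily

/-- A weighted graph: a simple graph with a real function on its edge set. -/
structure WeightedGraph (V : Type*) where
  /-- the underlying graph -/
  graph : SimpleGraph V
  /-- the weights of the edges -/
  weight : graph.edgeSet → ℝ

namespace WeightedGraph

variable {V : Type*} (G : WeightedGraph V)

/-- All edges have positive weight. -/
def IsPositive : Prop := ∀ e, 0 < G.weight e

/-- The weight `w(H)` of a subgraph `H`: the sum of the weights of the edges of `H`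
(the graphs here are finite). -/
noncomputable def subgraphWeight (H : G.graph.Subgraph) : ℝ :=
  ∑ᶠ e : H.edgeSet, G.weight ⟨e.1, H.edgeSet_subset e.2⟩

/-- `d` is the `2`-weight `D_{i,j}(G)`, the minimum of `w(H)` over the connected subgraphs `H`
of `G` that contain both `i` and `j`. -/
def IsTwoWeight (i j : V) (d : ℝ) : Prop :=
  IsLeast {r : ℝ | ∃ H : G.graph.Subgraph, H.Connected ∧ i ∈ H.verts ∧ j ∈ H.verts ∧
    r = G.subgraphWeight H} d

end WeightedGraph

open Classical in
/-- A caterpillar: a tree whose vertices of degree at least `2` are exactly the vertices of a path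
(the spine). The spine may be empty, which among trees on at least two vertices happens only for
the tree with a single edge. -/
def SimpleGraph.IsCaterpillar {V : Type*} [Fintype V] (C : SimpleGraph V) : Prop :=
  C.IsTree ∧ ((∀ x : V, C.degree x < 2) ∨
    ∃ (u v : V) (S : C.Walk u v), S.IsPath ∧ ∀ x : V, x ∈ S.support ↔ 2 ≤ C.degree x)

/-- The family is realized by a positive-weighted caterpillar with vertex set `[n]`. -/
def PairFamily.IsCaterpillarlike {n : ℕ} (D : PairFamily n) : Prop :=
  ∃ C : WeightedGraph (Fin n), C.graph.IsCaterpillar ∧ C.IsPositive ∧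
    ∀ i j : Fin n, i ≠ j → C.IsTwoWeight i j (D.entry i j)

/-!
A caterpillar metric is the metric of a comb. The spine is laid out on a real line, and a vertex `x`
gets the position `p x` of the spine vertex it hangs on and the height `h x`, the weight of its
twig, zero on the spine itself. Then `D_{x,y} = h x + h y + |p x - p y|` for `x ≠ y`, and each
position is taken by an element of height zero. These coordinates, `PairFamily.IsComb`, replace the
general theory of tree metrics: a family is caterpillarlike exactly if it has comb coordinates
(`IsCaterpillarlike.exists_isComb`, `IsComb.isCaterpillarlike`), and both directions of the theorem
become statements about points of a line.

* In comb coordinates the heights cancel from the four-point condition, which holds on the line, and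
  the median of three elements is the foot of the middle one. If `n ≥ 3` and the spine consists of
  the vertices of degree at least `2`, then `t_x = h x` (`IsComb.t_eq`), so that a maximal pair `a, b`
  realizes the largest distance of two positions. All positions lie between those of `a` and `b`,
  which gives the third condition (`IsComb.max_entry_add_entry_le`).
* Conversely let `p x = (D_{a,x} + D_{a,b} - D_{b,x}) / 2` and
  `h x = (D_{a,x} + D_{b,x} - D_{a,b}) / 2`. The foot of `x` is the median of `a, b, x`. By the
  four-point condition and the third condition,
  `D_{a,b} + D_{x,y} = max (D_{a,x} + D_{b,y}) (D_{a,y} + D_{b,x})`, which is the distance formula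
  of the comb (`exists_isComb_of_fourPoint_of_isMedian`). This uses nothing of `a, b` beyond `a ≠ b`
  and the third condition.

From comb coordinates a caterpillar is built by joining every element of positive height to its foot
and every element of the spine to its predecessor. On the graph side, the `2`-weight in a tree is the
weight of the unique path (`WeightedGraph.isTwoWeight_of_isPath`), and a path in a tree with a spine
runs along a twig, the spine and a twig (`WeightedGraph.exists_isPath_of_spine`).
-/

/-! ### Weights of walks and of subgraphs -/

/-- Weights as a function on all unordered pairs, zero outside the edge set. -/
noncomputable def WeightedGraph.pairWeight {V : Type*} (G : WeightedGraph V) (e : Sym2 V) : ℝ :=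
  open Classical in if h : e ∈ G.graph.edgeSet then G.weight ⟨e, h⟩ else 0

namespace WeightedGraph

variable {V : Type*} {G : WeightedGraph V}

theorem pairWeight_of_mem {e : Sym2 V} (h : e ∈ G.graph.edgeSet) :
    G.pairWeight e = G.weight ⟨e, h⟩ := dif_pos h

theorem pairWeight_diag (x : V) : G.pairWeight s(x, x) = 0 :=
  dif_neg (by simp)

theorem IsPositive.pairWeight_nonneg (hG : G.IsPositive) (e : Sym2 V) : 0 ≤ G.pairWeight e := by
  unfold pairWeight
  split
  · exact (hG _).le
  · exact le_rfl

theorem IsPositive.pairWeight_pos (hG : G.IsPositive) {x y : V} (h : G.graph.Adj x y) :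
    0 < G.pairWeight s(x, y) := by
  rw [pairWeight_of_mem (G.graph.mem_edgeSet.2 h)]
  exact hG _

/-- The total weight of a walk, edges being counted with multiplicity. -/
noncomputable def walkWeight (G : WeightedGraph V) {u v : V} (W : G.graph.Walk u v) : ℝ :=
  (W.edges.map G.pairWeight).sum

@[simp] theorem walkWeight_nil (u : V) : G.walkWeight (.nil : G.graph.Walk u u) = 0 := by
  simp [walkWeight]

@[simp] theorem walkWeight_cons {u v w : V} (h : G.graph.Adj u v) (W : G.graph.Walk v w) :
    G.walkWeight (.cons h W) = G.pairWeight s(u, v) + G.walkWeight W := by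
  simp [walkWeight]

theorem walkWeight_append {u v w : V} (W : G.graph.Walk u v) (W' : G.graph.Walk v w) :
    G.walkWeight (W.append W') = G.walkWeight W + G.walkWeight W' := by
  simp [walkWeight]

theorem walkWeight_concat {u v w : V} (W : G.graph.Walk u v) (h : G.graph.Adj v w) :
    G.walkWeight (W.concat h) = G.walkWeight W + G.pairWeight s(v, w) := by
  simp [walkWeight, SimpleGraph.Walk.edges_concat]

theorem walkWeight_reverse {u v : V} (W : G.graph.Walk u v) :
    G.walkWeight W.reverse = G.walkWeight W := by
  simp [walkWeight]

theorem IsPositive.walkWeight_nonneg (hG : G.IsPositive) {u v : V} (W : G.graph.Walk u v) :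
    0 ≤ G.walkWeight W :=
  List.sum_nonneg fun _ hr => by
    obtain ⟨e, -, rfl⟩ := List.mem_map.1 hr
    exact hG.pairWeight_nonneg e

theorem subgraphWeight_eq_sum [Finite V] (H : G.graph.Subgraph) :
    G.subgraphWeight H = ∑ e ∈ H.edgeSet.toFinite.toFinset, G.pairWeight e := by
  rw [← finsum_mem_eq_finite_toFinset_sum, ← finsum_set_coe_eq_finsum_mem, subgraphWeight]
  exact finsum_congr fun e => (pairWeight_of_mem (H.edgeSet_subset e.2)).symm

theorem walkWeight_eq_sum [DecidableEq V] {u v : V} {W : G.graph.Walk u v} (hW : W.IsPath) :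
    G.walkWeight W = ∑ e ∈ W.edges.toFinset, G.pairWeight e :=
  (List.sum_toFinset _ hW.isTrail.edges_nodup).symm

/-- In a positive-weighted tree the `2`-weight of `i` and `j` is the weight of the path joining
them: every connected subgraph containing `i` and `j` contains that path. -/
theorem isTwoWeight_of_isPath [Finite V] (hT : G.graph.IsTree) (hG : G.IsPositive) {i j : V}
    {W : G.graph.Walk i j} (hW : W.IsPath) : G.IsTwoWeight i j (G.walkWeight W) := by
  classical
  constructor
  · refine ⟨W.toSubgraph, W.toSubgraph_connected, W.start_mem_verts_toSubgraph,
      W.end_mem_verts_toSubgraph, ?_⟩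
    rw [subgraphWeight_eq_sum, walkWeight_eq_sum hW]
    refine Finset.sum_congr ?_ fun _ _ => rfl
    ext e
    simp
  · rintro r ⟨H, hH, hi, hj, rfl⟩
    obtain ⟨W', hW'⟩ := (SimpleGraph.Subgraph.connected_iff_forall_exists_walk_subgraph H).1 hH
      |>.2 hi hj
    have huniq : W = W'.bypass :=
      (hT.existsUnique_path i j).unique hW W'.bypass_isPath
    rw [subgraphWeight_eq_sum, walkWeight_eq_sum hW]
    refine Finset.sum_le_sum_of_subset_of_nonneg (fun e he => ?_)
      fun e _ _ => hG.pairWeight_nonneg e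
    rw [List.mem_toFinset, huniq] at he
    have := W'.mem_edges_toSubgraph.2 (W'.edges_bypass_subset_edges he)
    simpa using SimpleGraph.Subgraph.edgeSet_mono hW' this

/-- If all vertices outside `P` hang on a vertex of `P` and the vertices of `P` are joined inside
`P` by paths whose weights are the distances of real coordinates `q`, then so are all vertices, up
to the weights of the hanging edges. The foot of a vertex `x` is `s x`; for `x ∈ P` it is `x`
itself, and the hanging edge degenerates to a diagonal pair, of weight zero. -/
theorem exists_isPath_of_spine {P : Set V} {s : V → V} {q : V → ℝ}
    (hs : ∀ x, s x ∈ P) (hs_self : ∀ x ∈ P, s x = x) (hs_adj : ∀ x ∉ P, G.graph.Adj x (s x))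
    (hP : ∀ u ∈ P, ∀ v ∈ P, ∃ W : G.graph.Walk u v,
      W.IsPath ∧ (∀ z ∈ W.support, z ∈ P) ∧ G.walkWeight W = |q u - q v|)
    {x y : V} (hxy : x ≠ y) :
    ∃ W : G.graph.Walk x y, W.IsPath ∧
      G.walkWeight W = G.pairWeight s(x, s x) + G.pairWeight s(y, s y) + |q (s x) - q (s y)| := by
  have key : ∀ v ∈ P, ∃ W : G.graph.Walk x v, W.IsPath ∧ (∀ z ∈ W.support, z = x ∨ z ∈ P) ∧
      G.walkWeight W = G.pairWeight s(x, s x) + |q (s x) - q v| := by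
    intro v hv
    by_cases hx : x ∈ P
    · obtain ⟨W, h1, h2, h3⟩ := hP x hx v hv
      exact ⟨W, h1, fun z hz => Or.inr (h2 z hz), by rw [h3, hs_self x hx, pairWeight_diag]; ring⟩
    · obtain ⟨W, h1, h2, h3⟩ := hP (s x) (hs x) v hv
      refine ⟨.cons (hs_adj x hx) W, ?_, ?_, ?_⟩
      · exact (SimpleGraph.Walk.cons_isPath_iff _ _).2 ⟨h1, fun h => hx (h2 x h)⟩
      · intro z hz
        rw [SimpleGraph.Walk.support_cons, List.mem_cons] at hz
        exact hz.imp_right (h2 z)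
      · rw [walkWeight_cons, h3]
  by_cases hy : y ∈ P
  · obtain ⟨W, h1, -, h3⟩ := key y hy
    exact ⟨W, h1, by rw [h3, hs_self y hy, pairWeight_diag]; ring⟩
  · obtain ⟨W, h1, h2, h3⟩ := key (s y) (hs y)
    refine ⟨W.concat (hs_adj y hy).symm, ?_, ?_⟩
    · refine h1.concat (fun h => ?_) _
      rcases h2 y h with h | h
      · exact hxy h.symm
      · exact hy h
    · rw [walkWeight_concat, h3, Sym2.eq_swap (a := s y)]
      ring

end WeightedGraph

/-! ### Comb coordinates -/

namespace PairFamily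

variable {n : ℕ} {D : PairFamily n}

theorem entry_self (i : Fin n) : D.entry i i = 0 := dif_neg (by simp)

theorem entry_comm (i j : Fin n) : D.entry i j = D.entry j i := by
  unfold entry
  by_cases h : i = j
  · subst h; rfl
  · rw [dif_pos h, dif_pos (Ne.symm h)]
    congr 2
    exact Finset.pair_comm i j

theorem IsPositive.entry_pos (hD : D.IsPositive) {i j : Fin n} (h : i ≠ j) : 0 < D.entry i j := by
  rw [entry, dif_pos h]
  exact hD _

/-- Comb coordinates of a family: every `x` sits at height `h x` above the position `p x` of a line,
and the entries are the distances travelled along the comb. Every tooth has a foot of height zero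
among the elements. -/
structure IsComb (D : PairFamily n) (p h : Fin n → ℝ) : Prop where
  nonneg : ∀ x, 0 ≤ h x
  exists_foot : ∀ x, ∃ s, h s = 0 ∧ p s = p x
  entry_eq : ∀ x y, x ≠ y → D.entry x y = h x + h y + |p x - p y|

end PairFamily

/-! ### Families with comb coordinates satisfy the three conditions -/

namespace PairFamily

variable {n : ℕ} {D : PairFamily n} {p h : Fin n → ℝ}

namespace IsComb

/-- Towards an element of height zero the formula for the entries also holds on the diagonal. -/
theorem entry_eq_of_height_eq_zero (H : D.IsComb p h) (x : Fin n) {m : Fin n} (hm : h m = 0) :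
    D.entry x m = h x + |p x - p m| := by
  by_cases hx : x = m
  · subst hx
    simp [entry_self, hm]
  · rw [H.entry_eq x m hx, hm, add_zero]

theorem eq_of_height_eq_zero (H : D.IsComb p h) (hD : D.IsPositive) {x y : Fin n}
    (hx : h x = 0) (hy : h y = 0) (hp : p x = p y) : x = y := by
  by_contra hxy
  have := hD.entry_pos hxy
  rw [H.entry_eq x y hxy, hx, hy, hp] at this
  simp at this

theorem fourPoint (H : D.IsComb p h) : D.FourPoint := by
  intro i j k l hij hik hil hjk hjl hkl
  rw [H.entry_eq i j hij, H.entry_eq k l hkl, H.entry_eq i k hik, H.entry_eq j l hjl,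
    H.entry_eq i l hil, H.entry_eq k j hjk.symm, abs_sub_comm (p k) (p j)]
  unfold MaxAttainedTwice
  -- The heights cancel, and four points of a line satisfy the condition in each of their orders.
  rcases abs_cases (p i - p j) with h1 | h1 <;> rcases abs_cases (p i - p k) with h2 | h2 <;>
  rcases abs_cases (p i - p l) with h3 | h3 <;> rcases abs_cases (p j - p k) with h4 | h4 <;>
  rcases abs_cases (p j - p l) with h5 | h5 <;> rcases abs_cases (p k - p l) with h6 | h6 <;>
  first
  | (left; constructor <;> linarith)
  | (right; left; constructor <;> linarith)
  | (right; right; constructor <;> linarith)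

/-- The median of three elements is the foot of the one in the middle. -/
theorem existsUnique_median_of_le (H : D.IsComb p h) (hD : D.IsPositive) {x y z : Fin n}
    (hxy : x ≠ y) (hxz : x ≠ z) (hyz : y ≠ z) (h1 : p x ≤ p y) (h2 : p y ≤ p z)
    {T : Set (Fin n)} (hT : T = {x, y, z}) :
    ∃! m : Fin n, ∀ i ∈ T, ∀ j ∈ T, i ≠ j → D.entry i j = D.entry i m + D.entry j m := by
  subst hT
  obtain ⟨m, hm, hpm⟩ := H.exists_foot y
  have exy := H.entry_eq x y hxy
  have exz := H.entry_eq x z hxz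
  have eyz := H.entry_eq y z hyz
  rw [abs_of_nonpos (by linarith)] at exy exz eyz
  refine ⟨m, ?_, fun m' hm' => ?_⟩
  · have ex := H.entry_eq_of_height_eq_zero x hm
    have ey := H.entry_eq_of_height_eq_zero y hm
    have ez := H.entry_eq_of_height_eq_zero z hm
    rw [hpm] at ex ey ez
    rw [abs_of_nonpos (by linarith)] at ex ey
    rw [abs_of_nonneg (by linarith)] at ez
    rintro i (rfl | rfl | rfl) j (rfl | rfl | rfl) hij <;>
      first
      | exact absurd rfl hij
      | linarith
      | (rw [entry_comm]; linarith)
  · have mxy := hm' x (by simp) y (by simp) hxy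
    have mxz := hm' x (by simp) z (by simp) hxz
    have myz := hm' y (by simp) z (by simp) hyz
    have hn := H.nonneg m'
    have key : h m' = 0 ∧ p m' = p y := by
      by_cases hx : x = m'
      · subst hx
        rw [entry_comm y x, entry_comm z x] at myz
        constructor <;> linarith
      by_cases hz : z = m'
      · subst hz
        constructor <;> linarith
      by_cases hy : y = m'
      · subst hy
        rw [entry_comm z y] at mxz
        exact ⟨by linarith, rfl⟩
      have ex := H.entry_eq x m' hx
      have ey := H.entry_eq y m' hy
      have ez := H.entry_eq z m' hz
      have ax := neg_abs_le (p x - p m')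
      have ay := neg_abs_le (p y - p m')
      have ay' := le_abs_self (p y - p m')
      have az := le_abs_self (p z - p m')
      constructor <;> linarith
    exact H.eq_of_height_eq_zero hD key.1 hm (key.2.trans hpm.symm)

theorem isMedian (H : D.IsComb p h) (hD : D.IsPositive) : D.IsMedian := by
  intro x y z hxy hxz hyz
  rcases le_total (p x) (p y) with h1 | h1 <;> rcases le_total (p y) (p z) with h2 | h2 <;>
    rcases le_total (p x) (p z) with h3 | h3
  · exact H.existsUnique_median_of_le hD hxy hxz hyz h1 h2 rfl
  · exact H.existsUnique_median_of_le hD hxy hxz hyz h1 h2 rfl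
  · exact H.existsUnique_median_of_le hD hxz hxy hyz.symm h3 h2 (by grind)
  · exact H.existsUnique_median_of_le hD hxz.symm hyz.symm hxy h3 h1 (by grind)
  · exact H.existsUnique_median_of_le hD hxy.symm hyz hxz h1 h3 (by grind)
  · exact H.existsUnique_median_of_le hD hyz hxy.symm hxz.symm h2 h3 (by grind)
  · exact H.existsUnique_median_of_le hD hyz.symm hxz.symm hxy.symm h2 h1 (by grind)
  · exact H.existsUnique_median_of_le hD hyz.symm hxz.symm hxy.symm h2 h1 (by grind)

/-- If every element of height zero lies strictly between two others, then `t_x` is the height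
of `x`. -/
theorem t_eq (H : D.IsComb p h)
    (hb : ∀ x, h x = 0 → ∃ y z, y ≠ x ∧ z ≠ x ∧ D.entry y z = D.entry x y + D.entry x z)
    (x : Fin n) : D.t x = h x := by
  have hleast : IsLeast {r : ℝ | ∃ y z : Fin n, y ≠ x ∧ z ≠ x ∧
      r = D.entry x y + D.entry x z - D.entry y z} (2 * h x) := by
    constructor
    · by_cases hx : h x = 0
      · obtain ⟨y, z, hy, hz, e⟩ := hb x hx
        exact ⟨y, z, hy, hz, by rw [e, hx]; ring⟩
      · obtain ⟨s, hs, hps⟩ := H.exists_foot x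
        have hsx : s ≠ x := by rintro rfl; exact hx hs
        refine ⟨s, s, hsx, hsx, ?_⟩
        rw [H.entry_eq_of_height_eq_zero x hs, hps, entry_self]
        simp
        ring
    · rintro r ⟨y, z, hy, hz, rfl⟩
      have hny := H.nonneg y
      have ey := H.entry_eq x y hy.symm
      by_cases hyz : y = z
      · subst hyz
        have := abs_nonneg (p x - p y)
        rw [entry_self]
        linarith
      · rw [ey, H.entry_eq x z hz.symm, H.entry_eq y z hyz]
        have := abs_sub_le (p y) (p x) (p z)
        rw [abs_sub_comm (p y) (p x)] at this
        linarith
  rw [t, hleast.csInf_eq]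
  ring

/-- If the heights are the numbers `t_x`, then a maximal pair consists of elements whose positions
are the two ends of the comb, and the third condition follows. -/
theorem max_entry_add_entry_le (H : D.IsComb p h) (ht : ∀ x, D.t x = h x) {a b : Fin n}
    (hab : D.IsMaxPair a b) {i j : Fin n} (hia : i ≠ a) (hib : i ≠ b) (hja : j ≠ a) (hjb : j ≠ b)
    (hij : i ≠ j) :
    max (D.entry a i + D.entry b j) (D.entry a j + D.entry b i) ≤
      D.entry a b + D.entry i j := by
  have hmax : ∀ x y : Fin n, x ≠ y → |p x - p y| ≤ |p a - p b| := by
    intro x y hxy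
    have := hab.2 x y hxy
    rw [ht, ht, ht, ht, H.entry_eq x y hxy, H.entry_eq a b hab.1] at this
    linarith
  have hai := hmax a i hia.symm
  have haj := hmax a j hja.symm
  have hbi := hmax b i hib.symm
  have hbj := hmax b j hjb.symm
  rw [H.entry_eq a i hia.symm, H.entry_eq b j hjb.symm, H.entry_eq a j hja.symm,
    H.entry_eq b i hib.symm, H.entry_eq a b hab.1, H.entry_eq i j hij]
  have h1 := le_abs_self (p i - p j)
  have h2 := neg_abs_le (p i - p j)
  apply max_le <;>
  rcases abs_cases (p a - p b) with c1 | c1 <;> rcases abs_cases (p a - p i) with c2 | c2 <;>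
  rcases abs_cases (p a - p j) with c3 | c3 <;> rcases abs_cases (p b - p i) with c4 | c4 <;>
  rcases abs_cases (p b - p j) with c5 | c5 <;> linarith

end IsComb

/-! ### The three conditions give comb coordinates -/

/-- With `a` and `b` as the two ends of the comb, positions and heights are Gromov products. The
median condition provides the feet, the four-point condition and the condition on `a, b` together
the distances. -/
theorem exists_isComb_of_fourPoint_of_isMedian (h4 : D.FourPoint) (hm : D.IsMedian) {a b : Fin n}
    (hab : a ≠ b)
    (h3 : ∀ i j : Fin n, i ≠ a → i ≠ b → j ≠ a → j ≠ b → i ≠ j →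
      max (D.entry a i + D.entry b j) (D.entry a j + D.entry b i) ≤
        D.entry a b + D.entry i j) (hD : D.IsPositive) :
    ∃ p h : Fin n → ℝ, D.IsComb p h := by
  have hnn : ∀ i j, 0 ≤ D.entry i j := fun i j => by
    by_cases hij : i = j
    · rw [hij, entry_self]
    · exact (hD.entry_pos hij).le
  have med : ∀ x, x ≠ a → x ≠ b → ∃ m, D.entry a b = D.entry a m + D.entry b m ∧
      D.entry a x = D.entry a m + D.entry x m ∧ D.entry b x = D.entry b m + D.entry x m := by
    intro x hxa hxb
    obtain ⟨m, hm, -⟩ := hm a b x hab hxa.symm hxb.symm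
    exact ⟨m, hm a (by simp) b (by simp) hab, hm a (by simp) x (by simp) hxa.symm,
      hm b (by simp) x (by simp) hxb.symm⟩
  have hba := D.entry_comm b a
  have ea := D.entry_self a
  have eb := D.entry_self b
  refine ⟨fun x => (D.entry a x + D.entry a b - D.entry b x) / 2,
    fun x => (D.entry a x + D.entry b x - D.entry a b) / 2, ?_, ?_, ?_⟩
  · intro x
    by_cases hxa : x = a
    · subst hxa; linarith
    by_cases hxb : x = b
    · subst hxb; linarith
    obtain ⟨m, m1, m2, m3⟩ := med x hxa hxb
    have := hnn x m
    linarith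
  · intro x
    by_cases hxa : x = a
    · subst hxa; exact ⟨x, by linarith, rfl⟩
    by_cases hxb : x = b
    · subst hxb; exact ⟨x, by linarith, rfl⟩
    obtain ⟨m, m1, m2, m3⟩ := med x hxa hxb
    exact ⟨m, by linarith, by linarith⟩
  · have end_eq : ∀ x, x ≠ a → x ≠ b → |D.entry a x - D.entry b x| ≤ D.entry a b := by
      intro x hxa hxb
      obtain ⟨m, m1, m2, m3⟩ := med x hxa hxb
      have := hnn a m
      have := hnn b m
      rw [abs_le]
      constructor <;> linarith
    intro x y hxy
    have hsplit : (D.entry a x + D.entry a b - D.entry b x) / 2 -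
        (D.entry a y + D.entry a b - D.entry b y) / 2 =
        ((D.entry a x + D.entry b y) - (D.entry a y + D.entry b x)) / 2 := by ring
    rw [hsplit]
    have hxy' := D.entry_comm x y
    -- The distance formula is this identity; for `x` or `y` equal to `a` or `b` it is a triangle
    -- inequality, otherwise the third condition selects the maximum in the four-point condition.
    suffices hmain : D.entry a b + D.entry x y =
        max (D.entry a x + D.entry b y) (D.entry a y + D.entry b x) by
      rw [max_def] at hmain
      rcases abs_cases (((D.entry a x + D.entry b y) - (D.entry a y + D.entry b x)) / 2) with
        c | c <;> split_ifs at hmain <;> linarith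
    by_cases hxa : x = a
    · subst hxa
      by_cases hyb : y = b
      · have := hnn x b
        subst hyb; rw [max_eq_right] <;> linarith
      · have := abs_le.1 (end_eq y hxy.symm hyb)
        rw [max_eq_right] <;> linarith
    by_cases hxb : x = b
    · subst hxb
      by_cases hya : y = a
      · have := hnn a x
        subst hya; rw [max_eq_left]
        linarith
      · have := abs_le.1 (end_eq y hya hxy.symm)
        rw [max_eq_left]
        linarith
    have hx := abs_le.1 (end_eq x hxa hxb)
    by_cases hya : y = a
    · subst hya
      rw [max_eq_left] <;> linarith
    by_cases hyb : y = b
    · subst hyb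
      rw [max_eq_right] <;> linarith
    have h3' := max_le_iff.1 (h3 x y hxa hxb hya hyb hxy)
    have h4' := h4 a b x y hab (Ne.symm hxa) (Ne.symm hya) (Ne.symm hxb) (Ne.symm hyb) hxy
    rw [entry_comm x b] at h4'
    rcases h4' with h | h | h
    · rw [max_eq_left] <;> linarith
    · rw [max_eq_right] <;> linarith
    · rw [max_eq_left] <;> linarith

end PairFamily

/-! ### A caterpillar gives comb coordinates -/

namespace SimpleGraph

variable {V : Type*} {G : SimpleGraph V}

theorem Adj.two_le_degree {x y z : V} [Fintype (G.neighborSet x)] (hy : G.Adj x y)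
    (hz : G.Adj x z) (hyz : y ≠ z) : 2 ≤ G.degree x :=
  Finset.one_lt_card.2 ⟨y, by simpa using hy, z, by simpa using hz, hyz⟩

theorem exists_adj_ne_of_two_le_degree {x : V} [Fintype (G.neighborSet x)]
    (h : 2 ≤ G.degree x) : ∃ y z, G.Adj x y ∧ G.Adj x z ∧ y ≠ z := by
  obtain ⟨y, hy, z, hz, hyz⟩ := Finset.one_lt_card.1 h
  exact ⟨y, z, by simpa using hy, by simpa using hz, hyz⟩

/-- If all vertices of degree at least `2` lie in `P`, then a vertex outside `P` is adjacent to a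
vertex of `P`. -/
theorem Connected.exists_adj_mem_of_two_le_degree [G.LocallyFinite] (hG : G.Connected) {P : Set V}
    (hP : ∀ x, 2 ≤ G.degree x → x ∈ P) {u : V} (hu : u ∈ P) {x : V} (hx : x ∉ P) :
    ∃ y ∈ P, G.Adj x y := by
  obtain ⟨W, hW⟩ := (hG x u).exists_isPath
  cases W with
  | nil => exact absurd hu hx
  | @cons _ y _ hxy W =>
    refine ⟨y, ?_, hxy⟩
    by_contra hy
    cases W with
    | nil => exact hy hu
    | @cons _ z _ hyz W =>
      refine hy (hP y (hxy.symm.two_le_degree hyz ?_))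
      rintro rfl
      simp at hW

/-- A tree on at least three vertices has a vertex of degree at least `2`. -/
theorem IsTree.exists_two_le_degree [Fintype V] [DecidableRel G.Adj] (hG : G.IsTree)
    (hV : 3 ≤ Fintype.card V) : ∃ x, 2 ≤ G.degree x := by
  by_contra! hlt
  have h1 := G.sum_degrees_eq_twice_card_edges
  have h2 := hG.card_edgeFinset
  have h3 : ∑ x, G.degree x ≤ ∑ _x : V, 1 := Finset.sum_le_sum fun x _ => by
    have := hlt x
    omega
  rw [Finset.sum_const, Finset.card_univ, smul_eq_mul, mul_one] at h3
  omega

end SimpleGraph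

namespace PairFamily

variable {n : ℕ} {D : PairFamily n} {C : WeightedGraph (Fin n)}

theorem walkWeight_eq_entry (hT : C.graph.IsTree) (hC : C.IsPositive)
    (hDC : ∀ i j : Fin n, i ≠ j → C.IsTwoWeight i j (D.entry i j)) {i j : Fin n}
    {W : C.graph.Walk i j} (hW : W.IsPath) : C.walkWeight W = D.entry i j := by
  by_cases hij : i = j
  · subst hij
    rw [(SimpleGraph.Walk.isPath_iff_nil.1 hW).eq_nil, C.walkWeight_nil, entry_self]
  · exact (WeightedGraph.isTwoWeight_of_isPath hT hC hW).unique (hDC i j hij)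

/-- Along a path starting at `u`, distances are differences of distances from `u`. -/
theorem exists_isPath_of_mem_support (hT : C.graph.IsTree) (hC : C.IsPositive)
    (hDC : ∀ i j : Fin n, i ≠ j → C.IsTwoWeight i j (D.entry i j)) {u v : Fin n}
    {S : C.graph.Walk u v} (hS : S.IsPath) {x y : Fin n} (hx : x ∈ S.support)
    (hy : y ∈ S.support) :
    ∃ W : C.graph.Walk x y, W.IsPath ∧ (∀ z ∈ W.support, z ∈ S.support) ∧
      C.walkWeight W = |D.entry u x - D.entry u y| := by
  have hwt := @walkWeight_eq_entry n D C hT hC hDC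
  by_cases hy' : y ∈ (S.takeUntil x hx).support
  · have hT := hS.takeUntil hx
    have hspec := (S.takeUntil x hx).take_spec hy'
    have hadd := C.walkWeight_append ((S.takeUntil x hx).takeUntil y hy')
      ((S.takeUntil x hx).dropUntil y hy')
    rw [hspec, hwt hT, hwt (hT.takeUntil hy')] at hadd
    refine ⟨((S.takeUntil x hx).dropUntil y hy').reverse, (hT.dropUntil hy').reverse,
      fun z hz => ?_, ?_⟩
    · rw [SimpleGraph.Walk.support_reverse, List.mem_reverse] at hz
      exact S.support_takeUntil_subset_support hx
        ((S.takeUntil x hx).support_dropUntil_subset_support hy' hz)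
    · rw [C.walkWeight_reverse, hadd, add_sub_cancel_left, abs_of_nonneg (hC.walkWeight_nonneg _)]
  · have hy'' : y ∈ (S.dropUntil x hx).support := by
      rw [← S.take_spec hx, SimpleGraph.Walk.mem_support_append_iff] at hy
      exact hy.resolve_left hy'
    have hA := (hS.dropUntil hx).takeUntil hy''
    have hB : ((S.takeUntil x hx).append ((S.dropUntil x hx).takeUntil y hy'')).IsPath := by
      apply SimpleGraph.Walk.IsPath.of_append_left (q := (S.dropUntil x hx).dropUntil y hy'')
      rw [← SimpleGraph.Walk.append_assoc, SimpleGraph.Walk.take_spec, SimpleGraph.Walk.take_spec]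
      exact hS
    have hadd := C.walkWeight_append (S.takeUntil x hx) ((S.dropUntil x hx).takeUntil y hy'')
    rw [hwt hB, hwt (hS.takeUntil hx)] at hadd
    refine ⟨(S.dropUntil x hx).takeUntil y hy'', hA, fun z hz => ?_, ?_⟩
    · exact S.support_dropUntil_subset_support hx
        ((S.dropUntil x hx).support_takeUntil_subset_support hy'' hz)
    · rw [hadd, sub_add_cancel_left, abs_neg, abs_of_nonneg (hC.walkWeight_nonneg _)]

/-- The spine of the caterpillar carries the positions and the twigs are the teeth. Since the spine
consists of the vertices of degree at least `2`, each of its elements lies between two others. -/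
theorem IsCaterpillarlike.exists_isComb (hn : 3 ≤ n) (hD : D.IsCaterpillarlike) :
    ∃ p h : Fin n → ℝ, D.IsComb p h ∧
      ∀ x, h x = 0 → ∃ y z, y ≠ x ∧ z ≠ x ∧ D.entry y z = D.entry x y + D.entry x z := by
  classical
  obtain ⟨C, ⟨hT, hspine⟩, hC, hDC⟩ := hD
  have hwt := @walkWeight_eq_entry n D C hT hC hDC
  obtain ⟨u, v, S, hS, hdeg⟩ : ∃ (u v : Fin n) (S : C.graph.Walk u v), S.IsPath ∧
      ∀ x : Fin n, x ∈ S.support ↔ 2 ≤ C.graph.degree x := by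
    refine hspine.resolve_left fun hlt => ?_
    obtain ⟨x, hx⟩ := hT.exists_two_le_degree (by simpa using hn)
    have := hlt x
    -- `IsCaterpillar` computes degrees with classical decidability instances.
    convert (this.trans_le hx).false
  have hfoot : ∀ x, ∃ y ∈ S.support, (x ∈ S.support → y = x) ∧
      (x ∉ S.support → C.graph.Adj x y) := by
    intro x
    by_cases hx : x ∈ S.support
    · exact ⟨x, hx, fun _ => rfl, fun h => absurd hx h⟩
    · obtain ⟨y, hy, hxy⟩ := hT.connected.exists_adj_mem_of_two_le_degree
        (P := {x | x ∈ S.support}) (fun x h => (hdeg x).2 h) S.start_mem_support hx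
      exact ⟨y, hy, fun h => absurd h hx, fun _ => hxy⟩
  choose s hs hs_self hs_adj using hfoot
  refine ⟨fun x => D.entry u (s x), fun x => C.pairWeight s(x, s x),
    ⟨fun x => hC.pairWeight_nonneg _, fun x => ⟨s x, ?_, ?_⟩, fun x y hxy => ?_⟩, fun x hx => ?_⟩
  · rw [hs_self _ (hs x), C.pairWeight_diag]
  · rw [hs_self _ (hs x)]
  · obtain ⟨W, hW, hWt⟩ := C.exists_isPath_of_spine (P := {x | x ∈ S.support}) (q := D.entry u)
      hs hs_self hs_adj
      (fun x hx y hy => exists_isPath_of_mem_support hT hC hDC hS hx hy) hxy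
    rw [← hwt hW, hWt]
  · have hxS : x ∈ S.support := by
      by_contra hxS
      exact (hC.pairWeight_pos (hs_adj x hxS)).ne' hx
    obtain ⟨y, z, hy, hz, hyz⟩ :=
      SimpleGraph.exists_adj_ne_of_two_le_degree ((hdeg x).1 hxS)
    have e1 := hwt (W := .cons hy .nil) (by simp [hy.ne])
    have e2 := hwt (W := .cons hz .nil) (by simp [hz.ne])
    have e3 := hwt (W := .cons hy.symm (.cons hz .nil)) (by simp [hy.ne', hz.ne, hyz])
    rw [C.walkWeight_cons, C.walkWeight_nil] at e1 e2
    rw [C.walkWeight_cons, C.walkWeight_cons, C.walkWeight_nil, Sym2.eq_swap] at e3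
    exact ⟨y, z, hy.ne', hz.ne', by linarith⟩

end PairFamily

/-! ### Comb coordinates give a caterpillar -/

namespace PairFamily

variable {n : ℕ} {D : PairFamily n} {p h : Fin n → ℝ} {f : Fin n → Fin n}

/-- The map `f` sends an element of positive height to its foot and an element of height zero to
the preceding one on the line, the first one to itself. -/
structure IsCombParent (p h : Fin n → ℝ) (f : Fin n → Fin n) : Prop where
  height_eq_zero : ∀ x, h (f x) = 0
  of_ne : ∀ x, h x ≠ 0 → p (f x) = p x
  of_eq : ∀ x, h x = 0 → (f x = x ∧ ∀ z, h z = 0 → p x ≤ p z) ∨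
    (p (f x) < p x ∧ ∀ z, h z = 0 → p z < p x → p z ≤ p (f x))

theorem IsComb.exists_isCombParent (H : D.IsComb p h) : ∃ f, IsCombParent p h f := by
  classical
  have : ∀ x, ∃ y, h y = 0 ∧ (h x ≠ 0 → p y = p x) ∧
      (h x = 0 → (y = x ∧ ∀ z, h z = 0 → p x ≤ p z) ∨
        (p y < p x ∧ ∀ z, h z = 0 → p z < p x → p z ≤ p y)) := by
    intro x
    by_cases hx : h x = 0
    · by_cases hne : ∃ z, h z = 0 ∧ p z < p x
      · obtain ⟨z, hz⟩ := hne
        obtain ⟨y, hy, hmax⟩ := Finset.exists_max_image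
          (Finset.univ.filter fun z => h z = 0 ∧ p z < p x) p ⟨z, by simpa using hz⟩
        rw [Finset.mem_filter] at hy
        exact ⟨y, hy.2.1, fun h' => absurd hx h', fun _ => Or.inr ⟨hy.2.2, fun z h1 h2 =>
          hmax z (Finset.mem_filter.2 ⟨Finset.mem_univ z, h1, h2⟩)⟩⟩
      · push Not at hne
        exact ⟨x, hx, fun _ => rfl, fun _ => Or.inl ⟨rfl, hne⟩⟩
    · obtain ⟨s, hs, hps⟩ := H.exists_foot x
      exact ⟨s, hs, fun _ => hps, fun h' => absurd h' hx⟩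
  choose f h1 h2 h3 using this
  exact ⟨f, h1, h2, h3⟩

/-- The graph joining every element to its parent, each edge weighted by the entry of `D`. -/
def parentGraph (D : PairFamily n) (f : Fin n → Fin n) : WeightedGraph (Fin n) where
  graph := SimpleGraph.fromRel fun x y => f x = y
  weight e := Sym2.lift ⟨D.entry, entry_comm⟩ e.1

theorem parentGraph_adj {x y : Fin n} :
    (D.parentGraph f).graph.Adj x y ↔ x ≠ y ∧ (f x = y ∨ f y = x) :=
  SimpleGraph.fromRel_adj _ _ _

theorem pairWeight_parentGraph {x y : Fin n} (hxy : (D.parentGraph f).graph.Adj x y) :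
    (D.parentGraph f).pairWeight s(x, y) = D.entry x y :=
  WeightedGraph.pairWeight_of_mem ((D.parentGraph f).graph.mem_edgeSet.2 hxy)

theorem parentGraph_isPositive (hD : D.IsPositive) : (D.parentGraph f).IsPositive := by
  rintro ⟨e, he⟩
  induction e with
  | _ x y => exact hD.entry_pos ((D.parentGraph f).graph.mem_edgeSet.1 he).ne

theorem IsCombParent.adj_of_height_ne_zero (F : IsCombParent p h f) {x : Fin n} (hx : h x ≠ 0) :
    (D.parentGraph f).graph.Adj x (f x) :=
  parentGraph_adj.2 ⟨fun e => hx (e ▸ F.height_eq_zero x), Or.inl rfl⟩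

/-- Iterating the parent map leads from `y` down the spine to `u`. -/
theorem IsComb.exists_isPath_spine (H : D.IsComb p h) (hD : D.IsPositive)
    (F : IsCombParent p h f) {u : Fin n} (hu : h u = 0) (y : Fin n) (hy : h y = 0)
    (huy : p u ≤ p y) :
    ∃ W : (D.parentGraph f).graph.Walk y u, W.IsPath ∧
      (∀ x, x ∈ W.support ↔ h x = 0 ∧ p u ≤ p x ∧ p x ≤ p y) ∧
      (D.parentGraph f).walkWeight W = p y - p u := by
  have hwf : WellFounded fun x y : Fin n => p x < p y := by
    have : IsTrans (Fin n) fun x y => p x < p y := ⟨fun _ _ _ h1 h2 => lt_trans h1 h2⟩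
    have : Std.Irrefl fun x y : Fin n => p x < p y := ⟨fun _ => lt_irrefl _⟩
    exact Finite.wellFounded_of_trans_of_irrefl _
  induction y using hwf.induction with
  | _ y ih =>
  rcases huy.eq_or_lt with he | hlt
  · obtain rfl := H.eq_of_height_eq_zero hD hu hy he
    refine ⟨.nil, .nil, fun x => ?_, by simp⟩
    rw [SimpleGraph.Walk.support_nil, List.mem_singleton]
    constructor
    · rintro rfl
      exact ⟨hu, le_rfl, le_rfl⟩
    · rintro ⟨h1, h2, h3⟩
      exact H.eq_of_height_eq_zero hD h1 hu (le_antisymm h3 h2)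
  · have hfy := F.height_eq_zero y
    obtain ⟨h1, h2⟩ := (F.of_eq y hy).resolve_left fun h' => (h'.2 u hu).not_gt hlt
    obtain ⟨W, hW, hsupp, hwt⟩ := ih (f y) h1 hfy (h2 u hu hlt)
    have hadj : (D.parentGraph f).graph.Adj y (f y) :=
      parentGraph_adj.2 ⟨fun e => h1.ne (congrArg p e.symm), Or.inl rfl⟩
    refine ⟨.cons hadj W, ?_, fun x => ?_, ?_⟩
    · exact (SimpleGraph.Walk.cons_isPath_iff _ _).2
        ⟨hW, fun h' => ((hsupp y).1 h').2.2.not_gt h1⟩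
    · rw [SimpleGraph.Walk.support_cons, List.mem_cons, hsupp]
      constructor
      · rintro (rfl | ⟨h3, h4, h5⟩)
        · exact ⟨hy, huy, le_rfl⟩
        · exact ⟨h3, h4, h5.trans h1.le⟩
      · rintro ⟨h3, h4, h5⟩
        rcases h5.eq_or_lt with h6 | h6
        · exact Or.inl (H.eq_of_height_eq_zero hD h3 hy h6)
        · exact Or.inr ⟨h3, h4, h2 x h3 h6⟩
    · rw [WeightedGraph.walkWeight_cons, pairWeight_parentGraph hadj, hwt,
        H.entry_eq_of_height_eq_zero y hfy, hy, abs_of_pos (by linarith)]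
      ring

/-- Every element other than the first of the spine contributes the edge to its parent, so the
connected graph has one edge less than vertices. -/
theorem IsComb.isTree_parentGraph (H : D.IsComb p h) (hD : D.IsPositive)
    (F : IsCombParent p h f) (a : Fin n) : (D.parentGraph f).graph.IsTree := by
  classical
  obtain ⟨s, hs, -⟩ := H.exists_foot a
  obtain ⟨r, hr, hmin⟩ := Finset.exists_min_image (Finset.univ.filter fun z => h z = 0) p
    ⟨s, by simpa using hs⟩
  simp only [Finset.mem_filter, Finset.mem_univ, true_and] at hr hmin
  have hfr : f r = r := by
    rcases F.of_eq r hr with h' | h'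
    · exact h'.1
    · exact absurd h'.1 (hmin _ (F.height_eq_zero r)).not_gt
  have hspine : ∀ x, h x = 0 → (D.parentGraph f).graph.Reachable x r := fun x hx => by
    obtain ⟨W, -⟩ := H.exists_isPath_spine hD F hr x hx (hmin x hx)
    exact W.reachable
  have hreach : ∀ x, (D.parentGraph f).graph.Reachable x r := fun x => by
    by_cases hx : h x = 0
    · exact hspine x hx
    · exact (F.adj_of_height_ne_zero hx).reachable.trans (hspine _ (F.height_eq_zero x))
  have hconn : (D.parentGraph f).graph.Connected :=
    SimpleGraph.connected_iff_exists_forall_reachable _ |>.2 ⟨r, fun x => (hreach x).symm⟩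
  refine SimpleGraph.isTree_iff_connected_and_card.2
    ⟨hconn, le_antisymm ?_ hconn.card_vert_le_card_edgeSet_add_one⟩
  have hsub : (D.parentGraph f).graph.edgeSet ⊆ (fun x => s(x, f x)) '' {r}ᶜ := by
    intro e
    induction e with
    | _ x y =>
    rw [SimpleGraph.mem_edgeSet, parentGraph_adj]
    rintro ⟨hxy, rfl | rfl⟩
    · exact ⟨x, fun hx => hxy (by rw [Set.mem_singleton_iff.1 hx, hfr]), rfl⟩
    · exact ⟨y, fun hy => hxy (by rw [Set.mem_singleton_iff.1 hy, hfr]), Sym2.eq_swap⟩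
  have h1 := (Set.ncard_le_ncard hsub).trans (Set.ncard_image_le (Set.toFinite _))
  have h2 := Set.ncard_add_ncard_compl ({r} : Set (Fin n))
  rw [Set.ncard_singleton] at h2
  rw [Nat.card_coe_set_eq]
  omega

/-- The spine may end in vertices of degree `1`; the vertices of degree at least `2` still fill an
interval of it. -/
theorem IsComb.isCaterpillar_parentGraph (H : D.IsComb p h) (hD : D.IsPositive)
    (F : IsCombParent p h f) (a : Fin n) : (D.parentGraph f).graph.IsCaterpillar := by
  classical
  refine ⟨H.isTree_parentGraph hD F a, ?_⟩
  by_cases hT : ∀ x, (D.parentGraph f).graph.degree x < 2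
  · refine Or.inl fun x => ?_
    convert hT x
  right
  push Not at hT
  have hspine : ∀ x, 2 ≤ (D.parentGraph f).graph.degree x → h x = 0 := by
    intro x hx
    by_contra hx0
    obtain ⟨y, z, hy, hz, hyz⟩ := SimpleGraph.exists_adj_ne_of_two_le_degree hx
    have key : ∀ w, (D.parentGraph f).graph.Adj x w → f x = w := fun w hw =>
      (parentGraph_adj.1 hw).2.resolve_right fun e => hx0 (e ▸ F.height_eq_zero w)
    exact hyz ((key y hy).symm.trans (key z hz))
  obtain ⟨w, hw⟩ := hT
  obtain ⟨u, hu, hmin⟩ := Finset.exists_min_image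
    (Finset.univ.filter fun z => 2 ≤ (D.parentGraph f).graph.degree z) p ⟨w, by simpa using hw⟩
  obtain ⟨v, hv, hmax⟩ := Finset.exists_max_image
    (Finset.univ.filter fun z => 2 ≤ (D.parentGraph f).graph.degree z) p ⟨w, by simpa using hw⟩
  simp only [Finset.mem_filter, Finset.mem_univ, true_and] at hu hmin hv hmax
  obtain ⟨W, hW, hsupp, -⟩ := H.exists_isPath_spine hD F (hspine u hu) v (hspine v hv) (hmin v hv)
  refine ⟨v, u, W, hW, fun x => ?_⟩
  suffices hmain : x ∈ W.support ↔ 2 ≤ (D.parentGraph f).graph.degree x by convert hmain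
  rw [hsupp]
  refine ⟨fun ⟨hx, hux, hxv⟩ => ?_, fun hx => ⟨hspine x hx, hmin x hx, hmax x hx⟩⟩
  rcases hux.eq_or_lt with e | hux
  · rwa [← H.eq_of_height_eq_zero hD (hspine u hu) hx e]
  rcases hxv.eq_or_lt with e | hxv
  · rwa [H.eq_of_height_eq_zero hD hx (hspine v hv) e]
  -- Strictly inside, `x` has a parent on one side and the next spine vertex `z` on the other.
  obtain ⟨hlt, -⟩ := (F.of_eq x hx).resolve_left fun h' => (h'.2 u (hspine u hu)).not_gt hux
  obtain ⟨z, hz, hzmin⟩ := Finset.exists_min_image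
    (Finset.univ.filter fun z => h z = 0 ∧ p x < p z) p ⟨v, by simpa using ⟨hspine v hv, hxv⟩⟩
  simp only [Finset.mem_filter, Finset.mem_univ, true_and] at hz hzmin
  obtain ⟨hlt', hle⟩ := (F.of_eq z hz.1).resolve_left fun h' => (h'.2 x hx).not_gt hz.2
  have hfz : f z = x := by
    refine (H.eq_of_height_eq_zero hD hx (F.height_eq_zero z)
      (le_antisymm (hle x hx hz.2) (not_lt.1 fun h' => ?_))).symm
    exact (hzmin _ ⟨F.height_eq_zero z, h'⟩).not_gt hlt'
  have hxz : x ≠ z := fun e => hz.2.ne (congrArg p e)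
  have hxf : x ≠ f x := fun e => hlt.ne (congrArg p e.symm)
  refine SimpleGraph.Adj.two_le_degree (y := f x) (z := z) (parentGraph_adj.2 ⟨hxf, Or.inl rfl⟩)
    (parentGraph_adj.2 ⟨hxz, Or.inr hfz⟩) fun e => ?_
  rw [e] at hlt
  exact hlt.not_gt hz.2

theorem IsComb.isCaterpillarlike (H : D.IsComb p h) (hD : D.IsPositive) (a : Fin n) :
    D.IsCaterpillarlike := by
  classical
  obtain ⟨f, F⟩ := H.exists_isCombParent
  have hT := H.isTree_parentGraph hD F a
  have hC : (D.parentGraph f).IsPositive := parentGraph_isPositive hD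
  refine ⟨D.parentGraph f, H.isCaterpillar_parentGraph hD F a, hC, fun i j hij => ?_⟩
  have hpath : ∀ u, h u = 0 → ∀ v, h v = 0 → ∃ W : (D.parentGraph f).graph.Walk u v,
      W.IsPath ∧ (∀ z ∈ W.support, h z = 0) ∧
        (D.parentGraph f).walkWeight W = |p u - p v| := by
    intro u hu v hv
    rcases le_total (p v) (p u) with hle | hle
    · obtain ⟨W, h1, h2, h3⟩ := H.exists_isPath_spine hD F hv u hu hle
      exact ⟨W, h1, fun z hz => ((h2 z).1 hz).1, by rw [h3, abs_of_nonneg (by linarith)]⟩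
    · obtain ⟨W, h1, h2, h3⟩ := H.exists_isPath_spine hD F hu v hv hle
      refine ⟨W.reverse, h1.reverse, fun z hz => ((h2 z).1 (by simpa using hz)).1, ?_⟩
      rw [WeightedGraph.walkWeight_reverse, h3, abs_of_nonpos (by linarith)]
      ring
  have hfoot : ∀ x, h (if h x = 0 then x else f x) = 0 := fun x => by
    split_ifs with hx
    · exact hx
    · exact F.height_eq_zero x
  have hwt : ∀ x, (D.parentGraph f).pairWeight s(x, if h x = 0 then x else f x) = h x := by
    intro x
    split_ifs with hx
    · rw [WeightedGraph.pairWeight_diag, hx]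
    · rw [pairWeight_parentGraph (F.adj_of_height_ne_zero hx),
        H.entry_eq_of_height_eq_zero x (F.height_eq_zero x), F.of_ne x hx]
      simp
  have hp : ∀ x, p (if h x = 0 then x else f x) = p x := fun x => by
    split_ifs with hx
    · rfl
    · exact F.of_ne x hx
  obtain ⟨W, hW, hWt⟩ := (D.parentGraph f).exists_isPath_of_spine (P := {x | h x = 0})
    (s := fun x => if h x = 0 then x else f x) (q := p) hfoot (fun x hx => if_pos hx)
    (fun x hx => by
      rw [if_neg (show ¬h x = 0 from hx)]
      exact F.adj_of_height_ne_zero hx) hpath hij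
  simp only [hwt, hp, ← H.entry_eq i j hij] at hWt
  rw [← hWt]
  exact WeightedGraph.isTwoWeight_of_isPath hT hC hW

end PairFamily

/-! ### The characterization -/

theorem mainTheorem2 (n : ℕ) (hn : 2 ≤ n) (D : PairFamily n) (hD : D.IsPositive)
    (a b : Fin n) (hab : D.IsMaxPair a b) :
    D.IsCaterpillarlike ↔
      D.FourPoint ∧ D.IsMedian ∧
        ∀ i j : Fin n, i ≠ a → i ≠ b → j ≠ a → j ≠ b → i ≠ j →
          max (D.entry a i + D.entry b j) (D.entry a j + D.entry b i) ≤
            D.entry a b + D.entry i j := by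
  constructor
  · intro hcat
    rcases hn.eq_or_lt with rfl | hn
    · -- Each of the three conditions speaks of at least three distinct elements.
      refine ⟨fun i j k _ hij hik _ hjk => ?_, fun i j k hij hik hjk => ?_,
        fun i _ hia hib => ?_⟩
      · omega
      · omega
      · have := hab.1
        omega
    · obtain ⟨p, h, H, hb⟩ := hcat.exists_isComb hn
      exact ⟨H.fourPoint, H.isMedian hD, fun i j hia hib hja hjb hij =>
        H.max_entry_add_entry_le (H.t_eq hb) hab hia hib hja hjb hij⟩
  · rintro ⟨h4, hm, h3⟩
    obtain ⟨p, h, H⟩ := PairFamily.exists_isComb_of_fourPoint_of_isMedian h4 hm hab.1 h3 hD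
    exact H.isCaterpillarlike hD a
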